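/- Let $n\ge 2$, let $[n]=\{1,\dots,n\}$, and let $a_1,\dots,a_n$ be the annihilation operators on the $2^n$-dimensional fermionic Fock space, with $\{a_i^\dagger,a_j\}=\delta_{ij}\mathbb 1$, $\{a_i^\dagger,a_j^\dagger\}=0$ and unique vacuum $|0\rangle$. Let $\gamma\in\mathbb C$ with $\operatorname{Im}\gamma\neq 0$ and $|\gamma|\neq 1$, and let $M$ be the Hermitian $n\times n$ matrix (the reduced metric for the farthest impurities) $$M_{ij}=\begin{cases}1 & i=j,\\ -\mathrm i\,\operatorname{Im}\gamma\,(\gamma^*)^{j-i-1} & i<j,\\ \mathrm i\,\operatorname{Im}\gamma\,\gamma^{\,i-j-1} & i>j.\end{cases}$$ Let $\eta$ be the unique operator on Fock space with $\eta a_i^\dagger=\sum_j M_{ji}a_j^\dagger\eta$ for all $i$ and $\eta|0\rangle=|0\rangle$. An operator is Bravyi-Kitaev local to $S\subseteq[n]$ if it is a linear combination of products $\prod_{i\in P}a_i^\dagger\prod_{j\in Q}a_j$ with $P,Q\subseteq S$ and $|P|+|Q|$ even; it is extensively local over $S$ if it is local to $S$ and not local to any proper subset of $S$. For $A\subseteq[n]$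 let $G_A$ be the graph on $A$ in which $i,i+1$ are adjacent whenever both lie in $A$, and call the vertex sets of its connected components the components of $A$; the distance of two components is $\min|i-j|$ over sites $i$ of the one and $j$ of the other. For $A\neq\emptyset$ the edge components are the component containing $\min A$ (leftmost) and the one containing $\max A$ (rightmost). Suppose that there is an operator $O$ that is Bravyi-Kitaev extensively local over $A\subseteq[n]$ and satisfies $\eta O=O^\dagger\eta$. Then: 1. If $C$ is a component of $A$ with $|C|\le 2$ and $C\notin\{\{1,2\},\{n-1,n\}\}$, then $A$ has at least one other component, so $A\neq C$. 2. If $\{i\}$ is a component of $A$, then $i-2\in A$ whenever $i-2\in[n]$, and $i+2\in A$ whenever $i+2\in[n]$. 3. If $C$ is a component of $A$ with $|C|=2$ and $C\notin\{\{1,2\},\{n-1,n\}\}$, then some other component of $A$ is at distance at most $2$ from $C$. 4. If the leftmost component of $A$ has a single site, it is $\{1\}$; if the rightmost component of $A$ has a single site, it is $\{n\}$. -/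

import Mathlib

open scoped Matrix ComplexConjugate

namespace FreeFermion

/-- Operators on the `2 ^ n`-dimensional fermionic Fock space with orthonormal basis `|S⟩`,
`S ⊆ [n]`, written as matrices in this basis.  The adjoint is the conjugate transpose.
The site `k ∈ [n] = {1, …, n}` is the element of `Fin n` with value `k - 1`. -/
abbrev FockOp (n : ℕ) : Type := Matrix (Finset (Fin n)) (Finset (Fin n)) ℂ

/-- The basis vector `|T⟩`. -/
def ket {n : ℕ} (T : Finset (Fin n)) : Finset (Fin n) → ℂ := Pi.single T 1

/-- The vacuum `|0⟩ = |∅⟩`. -/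
def vac (n : ℕ) : Finset (Fin n) → ℂ := ket ∅

/-- The annihilation operator:
`a_i |T⟩ = (-1) ^ #{j ∈ T, j < i} |T \ {i}⟩` if `i ∈ T`, and `a_i |T⟩ = 0` otherwise. -/
def ann {n : ℕ} (i : Fin n) : FockOp n :=
  Matrix.of fun S T => if i ∈ T ∧ S = T.erase i then (-1) ^ (T.filter (· < i)).card else 0

/-- The creation operator, the adjoint of the annihilation operator. -/
def cre {n : ℕ} (i : Fin n) : FockOp n := (ann i)ᴴ

/-- The product of the operators `f i`, `i ∈ S`, in increasing order of the indices. -/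
def ordProd {n : ℕ} (f : Fin n → FockOp n) (S : Finset (Fin n)) : FockOp n :=
  ((S.sort (· ≤ ·)).map f).prod

/-- `a_i†` with the index transformed by `M`, that is `∑ j, M_{j i} a_j†`. -/
def creM {n : ℕ} (M : Matrix (Fin n) (Fin n) ℂ) (i : Fin n) : FockOp n := ∑ j, M j i • cre j

/-- The total metric `η` of a reduced metric `M`: the linear operator that maps the basis vector
`a_{i₁}† ⋯ a_{iₖ}† |0⟩` to `b_{i₁} ⋯ b_{iₖ} |0⟩`, where `b_i = ∑ j, M_{j i} a_j†`.
By `totalMetric_unique` below it is the unique solution of the equations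
`η a_i† = ∑ j, M_{j i} a_j† η` for all `i`, and `η |0⟩ = |0⟩`. -/
def totalMetric {n : ℕ} (M : Matrix (Fin n) (Fin n) ℂ) : FockOp n :=
  Matrix.of fun S T => (ordProd (creM M) T *ᵥ vac n) S

/-- Bravyi-Kitaev locality to `S`: the span of the even products of creation and annihilation
operators with indices in `S`. -/
def IsBKLocal {n : ℕ} (S : Finset (Fin n)) (O : FockOp n) : Prop :=
  O ∈ Submodule.span ℂ {X : FockOp n | ∃ A B : Finset (Fin n), A ⊆ S ∧ B ⊆ S ∧
    Even (A.card + B.card) ∧ X = ordProd cre A * ordProd ann B}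

/-- Extensive locality over `S`: local to `S`, and to no proper subset of `S`. -/
def IsBKExtensivelyLocal {n : ℕ} (S : Finset (Fin n)) (O : FockOp n) : Prop :=
  IsBKLocal S O ∧ ∀ S₁ : Finset (Fin n), S₁ ⊂ S → ¬ IsBKLocal S₁ O

/-- Quasi-Hermiticity `η O = O† η`. -/
def IsQuasiHermitian {n : ℕ} (η O : FockOp n) : Prop := η * O = Oᴴ * η

/-- The reduced metric for the farthest impurities. -/
def farM (n : ℕ) (γ : ℂ) : Matrix (Fin n) (Fin n) ℂ :=
  Matrix.of fun i j =>
    if i = j then 1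
    else if i < j then -Complex.I * (γ.im : ℂ) * (conj γ) ^ (j.val - i.val - 1)
    else Complex.I * (γ.im : ℂ) * γ ^ (i.val - j.val - 1)

/-- The graph `G_A`: the subgraph that `A` induces in the path graph on `[n]`. -/
def subGraph {n : ℕ} (A : Finset (Fin n)) : SimpleGraph (A : Set (Fin n)) :=
  (SimpleGraph.pathGraph n).induce (A : Set (Fin n))

/-- `C` is (the vertex set of) a connected component of `G_A`. -/
def IsComponent {n : ℕ} (A C : Finset (Fin n)) : Prop :=
  ∃ c : (subGraph A).ConnectedComponent, (C : Set (Fin n)) = Subtype.val '' c.supp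

/-- `min {d(i, j) : i ∈ C, j ∈ D}`, with the geodesic distance `d` of the path graph on `[n]`
(used for components, which are never empty). -/
noncomputable def setDist {n : ℕ} (C D : Finset (Fin n)) : ℕ :=
  sInf {d : ℕ | ∃ i ∈ C, ∃ j ∈ D, d = (SimpleGraph.pathGraph n).dist i j}

/-! ### The canonical anticommutation relations and the equations for the total metric -/

theorem ann_mulVec_ket {n : ℕ} (i : Fin n) (T : Finset (Fin n)) :
    ann i *ᵥ ket T =
      if i ∈ T then ((-1 : ℂ) ^ (T.filter (· < i)).card) • ket (T.erase i) else 0 := by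
  ext S
  by_cases h : i ∈ T <;> by_cases hS : S = T.erase i <;>
    simp [ket, ann, h, hS]

theorem cre_mulVec_ket {n : ℕ} (i : Fin n) (T : Finset (Fin n)) :
    cre i *ᵥ ket T =
      if i ∈ T then 0 else ((-1 : ℂ) ^ (T.filter (· < i)).card) • ket (insert i T) := by
  ext S
  by_cases h : i ∈ T
  · have : ¬ (i ∈ S ∧ T = S.erase i) := by rintro ⟨_, rfl⟩; simp at h
    simp [ket, cre, ann, h, this]
  · by_cases hS : S = insert i T
    · subst hS
      simp [ket, cre, ann, h, Finset.filter_insert]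
    · have : ¬ (i ∈ S ∧ T = S.erase i) := by
        rintro ⟨h1, rfl⟩; exact hS (Finset.insert_erase h1).symm
      simp [ket, cre, ann, h, this, hS]

theorem op_ext {n : ℕ} {X Y : FockOp n}
    (h : ∀ T, X *ᵥ ket T = Y *ᵥ ket T) : X = Y := by
  ext S T
  simpa [ket] using congrFun (h T) S

theorem cre_cre_of_lt {n : ℕ} {i j : Fin n} (h : i < j) :
    cre i * cre j + cre j * cre i = 0 := by
  apply op_ext
  intro T
  simp only [Matrix.add_mulVec, ← Matrix.mulVec_mulVec, cre_mulVec_ket, Matrix.zero_mulVec]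
  by_cases hi : i ∈ T <;> by_cases hj : j ∈ T <;>
    simp [hi, hj, h.ne, h.ne', Matrix.mulVec_smul, cre_mulVec_ket, Finset.filter_insert,
      h, h.not_gt, Finset.insert_comm i j, smul_smul, pow_succ, mul_comm]

/-- `{a_i†, a_j†} = 0`. -/
theorem cre_anticomm {n : ℕ} (i j : Fin n) : cre i * cre j + cre j * cre i = 0 := by
  rcases lt_trichotomy i j with h | rfl | h
  · exact cre_cre_of_lt h
  · apply op_ext
    intro T
    simp only [Matrix.add_mulVec, ← Matrix.mulVec_mulVec, cre_mulVec_ket, Matrix.zero_mulVec]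
    by_cases hi : i ∈ T <;> simp [hi, Matrix.mulVec_smul, cre_mulVec_ket]
  · rw [add_comm]; exact cre_cre_of_lt h

/-- `{a_i†, a_j} = δ_{ij} 1`. -/
theorem cre_ann_anticomm {n : ℕ} (i j : Fin n) :
    cre i * ann j + ann j * cre i = if i = j then 1 else 0 := by
  apply op_ext
  intro T
  simp only [Matrix.add_mulVec, ← Matrix.mulVec_mulVec, cre_mulVec_ket, ann_mulVec_ket]
  rcases lt_trichotomy i j with h | rfl | h
  · by_cases hi : i ∈ T <;> by_cases hj : j ∈ T <;>
      simp [hi, hj, h.ne, h.ne', Matrix.mulVec_smul, cre_mulVec_ket, ann_mulVec_ket,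
        Finset.filter_insert, Finset.filter_erase, h, h.not_gt, smul_smul, pow_succ, mul_comm,
        Finset.erase_insert_of_ne]
  · by_cases hi : i ∈ T <;>
      simp [hi, Matrix.mulVec_smul, cre_mulVec_ket, ann_mulVec_ket,
        Finset.filter_insert, Finset.filter_erase, smul_smul, ← mul_pow]
  · by_cases hi : i ∈ T <;> by_cases hj : j ∈ T
    · simp [hi, hj, h.ne', Matrix.mulVec_smul, cre_mulVec_ket]
    · simp [hi, hj, h.ne']
    · have h1 : j ∈ T.filter (· < i) := by simp [hj, h]
      have h2 : (-1 : ℂ) ^ (T.filter (· < i)).card =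
          -(-1 : ℂ) ^ ((T.filter (· < i)).erase j).card := by
        rw [← Finset.card_erase_add_one h1, pow_succ]
        ring
      rw [if_neg hi, if_pos hj, h2]
      simp [hi, hj, h.ne', Matrix.mulVec_smul, Matrix.mulVec_neg, cre_mulVec_ket, ann_mulVec_ket,
        Finset.filter_insert, Finset.filter_erase, h.not_gt, smul_smul, mul_comm,
        Finset.erase_insert_of_ne]
    · simp [hi, hj, h.ne, h.ne', Matrix.mulVec_smul, ann_mulVec_ket]

theorem ordProd_insert {n : ℕ} (f : Fin n → FockOp n) {m : Fin n} {S : Finset (Fin n)}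
    (h : ∀ x ∈ S, m < x) : ordProd f (insert m S) = f m * ordProd f S := by
  have hm : m ∉ S := fun hm => lt_irrefl m (h m hm)
  unfold ordProd
  rw [Finset.sort_insert _ (fun b hb => (h b hb).le) hm]
  simp

theorem mul_ordProd {n : ℕ} (b : Fin n → FockOp n) (hb : ∀ i j, b i * b j + b j * b i = 0)
    (i : Fin n) (S : Finset (Fin n)) :
    b i * ordProd b S =
      if i ∈ S then 0 else ((-1 : ℂ) ^ (S.filter (· < i)).card) • ordProd b (insert i S) := by
  have hsq : ∀ k, b k * b k = 0 := by
    intro k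
    have h := hb k k
    rw [← two_smul ℂ (b k * b k)] at h
    exact (smul_eq_zero.mp h).resolve_left two_ne_zero
  induction S using Finset.induction_on_min with
  | empty => simpa using (ordProd_insert b (m := i) (S := ∅) (by simp)).symm
  | insert m S hS ih =>
    have hmS : m ∉ S := fun hm => lt_irrefl m (hS m hm)
    rcases lt_trichotomy i m with h | rfl | h
    · have hlt : ∀ x ∈ insert m S, i < x := by
        intro x hx
        rcases Finset.mem_insert.mp hx with rfl | hx
        · exact h
        · exact h.trans (hS x hx)
      have hi : i ∉ insert m S := fun hi => lt_irrefl i (hlt i hi)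
      have hf : (insert m S).filter (· < i) = ∅ :=
        Finset.filter_eq_empty_iff.mpr fun x hx => (hlt x hx).not_gt
      rw [if_neg hi, hf, ordProd_insert b hlt]
      simp
    · rw [ordProd_insert b hS, ← mul_assoc, hsq]
      simp
    · have hc : b i * b m = -(b m * b i) := eq_neg_of_add_eq_zero_left (hb i m)
      rw [ordProd_insert b hS, ← mul_assoc, hc, neg_mul, mul_assoc, ih]
      by_cases hi : i ∈ S
      · simp [hi]
      · have hlt : ∀ x ∈ insert i S, m < x := by
          intro x hx
          rcases Finset.mem_insert.mp hx with rfl | hx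
          · exact h
          · exact hS x hx
        rw [Finset.insert_comm i m, ordProd_insert b hlt]
        simp [hi, h.ne', Finset.filter_insert, h, hmS, pow_succ]

theorem creM_anticomm {n : ℕ} (M : Matrix (Fin n) (Fin n) ℂ) (i j : Fin n) :
    creM M i * creM M j + creM M j * creM M i = 0 := by
  simp only [creM, Finset.sum_mul_sum, smul_mul_smul_comm]
  rw [Finset.sum_comm (f := fun k l => (M k j * M l i) • (cre k * cre l)),
    ← Finset.sum_add_distrib]
  refine Finset.sum_eq_zero fun k _ => ?_
  rw [← Finset.sum_add_distrib]
  refine Finset.sum_eq_zero fun l _ => ?_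
  rw [mul_comm (M l j), ← smul_add, cre_anticomm, smul_zero]

theorem totalMetric_mulVec_ket {n : ℕ} (M : Matrix (Fin n) (Fin n) ℂ) (T : Finset (Fin n)) :
    totalMetric M *ᵥ ket T = ordProd (creM M) T *ᵥ vac n := by
  ext S
  simp [ket, totalMetric]

/-- The total metric satisfies its defining equations. -/
theorem totalMetric_spec {n : ℕ} (M : Matrix (Fin n) (Fin n) ℂ) :
    (∀ i, totalMetric M * cre i = (∑ j, M j i • cre j) * totalMetric M) ∧
      totalMetric M *ᵥ vac n = vac n := by
  constructor
  · intro i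
    change _ = creM M i * _
    apply op_ext
    intro T
    rw [← Matrix.mulVec_mulVec _ (creM M i), totalMetric_mulVec_ket, Matrix.mulVec_mulVec,
      ← Matrix.mulVec_mulVec, mul_ordProd _ (creM_anticomm M), cre_mulVec_ket]
    by_cases hi : i ∈ T
    · simp [hi]
    · simp [hi, Matrix.mulVec_smul, totalMetric_mulVec_ket, Matrix.smul_mulVec]
  · rw [vac, totalMetric_mulVec_ket]
    simp [ordProd, vac]

/-- The defining equations of the total metric have no other solution. -/
theorem totalMetric_unique {n : ℕ} (M : Matrix (Fin n) (Fin n) ℂ) (η : FockOp n)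
    (h : ∀ i, η * cre i = (∑ j, M j i • cre j) * η) (h0 : η *ᵥ vac n = vac n) :
    η = totalMetric M := by
  apply op_ext
  intro T
  rw [totalMetric_mulVec_ket]
  induction T using Finset.induction_on_min with
  | empty => simpa [ordProd, vac] using h0
  | insert m S hS ih =>
    have hmS : m ∉ S := fun hm => lt_irrefl m (hS m hm)
    have hf : S.filter (· < m) = ∅ :=
      Finset.filter_eq_empty_iff.mpr fun x hx => (hS x hx).not_gt
    have h1 : ket (insert m S) = cre m *ᵥ ket S := by
      rw [cre_mulVec_ket, if_neg hmS, hf]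
      simp
    rw [h1, Matrix.mulVec_mulVec, h, ← Matrix.mulVec_mulVec, ih, ordProd_insert _ hS,
      ← Matrix.mulVec_mulVec]
    rfl

end FreeFermion

/-! The Fock-space statement reduces to a one-particle one. If `O` is an observable local to `A`,
even parity makes it commute with `a_b` and `a_b†` for every `b ∉ A`. Carrying `[a_b, O†] = 0`
through `η` shows that `O` also commutes with `∑ j, M_{b j} a_j`, provided `η` is injective on odd
operators over `A`. By duality, if every vector `k` with `k` and `M k` both supported on `A` has
`k_i = (M k)_i = 0`, then `O` commutes with `a_i` and `∑ j, M_{i j} a_j`, hence through `η` with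
`a_i†`, and is local to `A \ {i}`. Extensive locality therefore makes every site `i ∈ A` visible to
some such `k` (`exists_support_of_isQuasiHermitian`). The injectivity comes from
`farM_mulVec_eq_zero`, as soon as `A ≠ [n]`.

For the farthest impurities, `(M k)_i = k_i + i Im γ (L_i - R_i)`, where `L_{i+1} = γ L_i + k_i` and
`R_i = k_{i+1} + γ* R_{i+1}`. A site outside `A` imposes `k = 0` and `L = R`. Two adjacent such
sites force `L = R = 0`, because `|γ| ≠ 1`; the ends of the chain do the same to a site outside `A`,
because `L = 0` at the first site and `R = 0` at the last. A single site with zero amplitude at one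
neighbour, or a pair with zero amplitude at both neighbours, then carries neither `k` nor `M k`,
which contradicts visibility. So short components need nearby sites of `A` or a place at the end of
the chain. -/

namespace FreeFermion

variable {n : ℕ}

/-! ### Commutation of even local operators with the modes outside their support -/

theorem ann_anticomm (i j : Fin n) : ann i * ann j + ann j * ann i = 0 := by
  have h := congrArg Matrix.conjTranspose (cre_anticomm j i)
  simpa [cre, Matrix.conjTranspose_mul, Matrix.conjTranspose_add] using h

theorem conjTranspose_cre (i : Fin n) : (cre i)ᴴ = ann i := by simp [cre]

theorem ann_mul_self (i : Fin n) : ann i * ann i = 0 := by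
  have h := ann_anticomm i i
  rw [← two_smul ℂ (ann i * ann i)] at h
  exact (smul_eq_zero.mp h).resolve_left two_ne_zero

theorem cre_mul_self (i : Fin n) : cre i * cre i = 0 := by
  have h := cre_anticomm i i
  rw [← two_smul ℂ (cre i * cre i)] at h
  exact (smul_eq_zero.mp h).resolve_left two_ne_zero

theorem cre_ann_add (i : Fin n) : cre i * ann i + ann i * cre i = 1 := by
  simpa using cre_ann_anticomm i i

theorem cre_cre_swap (i j : Fin n) : cre i * cre j = -(cre j * cre i) :=
  eq_neg_of_add_eq_zero_left (cre_anticomm i j)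

theorem ann_ann_swap (i j : Fin n) : ann i * ann j = -(ann j * ann i) :=
  eq_neg_of_add_eq_zero_left (ann_anticomm i j)

theorem cre_ann_swap {i j : Fin n} (h : i ≠ j) : cre i * ann j = -(ann j * cre i) :=
  eq_neg_of_add_eq_zero_left (by rw [cre_ann_anticomm, if_neg h])

theorem ann_cre_swap {i j : Fin n} (h : i ≠ j) : ann i * cre j = -(cre j * ann i) := by
  rw [cre_ann_swap h.symm, neg_neg]

theorem mul_ordProd_of_swap {Y : FockOp n} {f : Fin n → FockOp n} {S : Finset (Fin n)}
    (h : ∀ j ∈ S, Y * f j = -(f j * Y)) :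
    Y * ordProd f S = (-1 : ℂ) ^ S.card • (ordProd f S * Y) := by
  induction S using Finset.induction_on_min with
  | empty => simp [ordProd]
  | insert m S hS ih =>
    have hmS : m ∉ S := fun hm => lt_irrefl m (hS m hm)
    rw [ordProd_insert f hS, ← mul_assoc, h m (by simp), neg_mul, mul_assoc,
      ih fun j hj => h j (by simp [hj])]
    simp [hmS, pow_succ, mul_assoc]

theorem mul_monomial_of_swap {Y : FockOp n} {P Q : Finset (Fin n)}
    (hP : ∀ j ∈ P, Y * cre j = -(cre j * Y)) (hQ : ∀ j ∈ Q, Y * ann j = -(ann j * Y)) :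
    Y * (ordProd cre P * ordProd ann Q) =
      (-1 : ℂ) ^ (P.card + Q.card) • (ordProd cre P * ordProd ann Q * Y) := by
  rw [← mul_assoc, mul_ordProd_of_swap hP, Matrix.smul_mul, mul_assoc, mul_ordProd_of_swap hQ]
  simp [smul_smul, pow_add, mul_assoc]

/-- Each factor of a monomial contributes one sign, and the monomials are even. -/
theorem IsBKLocal.commute {S : Finset (Fin n)} {O Y : FockOp n} (hO : IsBKLocal S O)
    (hc : ∀ j ∈ S, Y * cre j = -(cre j * Y)) (ha : ∀ j ∈ S, Y * ann j = -(ann j * Y)) :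
    Y * O = O * Y := by
  induction hO using Submodule.span_induction with
  | mem X hX =>
    obtain ⟨P, Q, hP, hQ, he, rfl⟩ := hX
    rw [mul_monomial_of_swap (fun j hj => hc j (hP hj)) (fun j hj => ha j (hQ hj)), he.neg_one_pow,
      one_smul]
  | zero => simp
  | add X Z _ _ h1 h2 => rw [mul_add, add_mul, h1, h2]
  | smul c X _ h => rw [Matrix.mul_smul, Matrix.smul_mul, h]

theorem IsBKLocal.cre_commute {S : Finset (Fin n)} {O : FockOp n} (hO : IsBKLocal S O)
    {b : Fin n} (hb : b ∉ S) : cre b * O = O * cre b :=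
  hO.commute (fun j _ => cre_cre_swap b j) fun _ hj => cre_ann_swap fun h => hb (h ▸ hj)

theorem IsBKLocal.ann_commute {S : Finset (Fin n)} {O : FockOp n} (hO : IsBKLocal S O)
    {b : Fin n} (hb : b ∉ S) : ann b * O = O * ann b :=
  hO.commute (fun _ hj => ann_cre_swap fun h => hb (h ▸ hj)) fun j _ => ann_ann_swap b j

/-! ### Locality from commutation -/

theorem ordProd_eq_mul_erase {b : Fin n → FockOp n} (hb : ∀ i j, b i * b j + b j * b i = 0)
    {i : Fin n} {S : Finset (Fin n)} (hi : i ∈ S) :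
    ∃ c : ℂ, ordProd b S = c • (b i * ordProd b (S.erase i)) := by
  refine ⟨(-1) ^ ((S.erase i).filter (· < i)).card, ?_⟩
  rw [mul_ordProd b hb, if_neg (by simp), Finset.insert_erase hi, smul_smul, ← mul_pow]
  simp

/-- The map `X ↦ a_i X a_i† + a_i† X a_i` sends an operator local to `A` to `U + a_i† a_i V` with
`U` and `V` local to `A \ {i}`. -/
theorem exists_of_local {A : Finset (Fin n)} {O : FockOp n} (hO : IsBKLocal A O) (i : Fin n) :
    ∃ U V : FockOp n, IsBKLocal (A.erase i) U ∧ IsBKLocal (A.erase i) V ∧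
      ann i * O * cre i + cre i * O * ann i = U + cre i * ann i * V := by
  induction hO using Submodule.span_induction with
  | zero => exact ⟨0, 0, Submodule.zero_mem _, Submodule.zero_mem _, by simp⟩
  | add X Z _ _ h1 h2 =>
    obtain ⟨U, V, hU, hV, h⟩ := h1
    obtain ⟨U', V', hU', hV', h'⟩ := h2
    refine ⟨U + U', V + V', Submodule.add_mem _ hU hU', Submodule.add_mem _ hV hV', ?_⟩
    simp only [mul_add, add_mul] at h h' ⊢
    rw [show ∀ a b c d : FockOp n, a + b + (c + d) = a + c + (b + d) by intros; abel, h, h']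
    abel
  | smul c X _ h =>
    obtain ⟨U, V, hU, hV, h⟩ := h
    refine ⟨c • U, c • V, Submodule.smul_mem _ _ hU, Submodule.smul_mem _ _ hV, ?_⟩
    simp only [Matrix.mul_smul, Matrix.smul_mul, ← smul_add, h]
  | mem X hX =>
    obtain ⟨P, Q, hP, hQ, he, rfl⟩ := hX
    have hcc : ∀ S : Finset (Fin n), ∀ j ∈ S, cre i * cre j = -(cre j * cre i) :=
      fun _ j _ => cre_cre_swap i j
    have haa : ∀ S : Finset (Fin n), ∀ j ∈ S, ann i * ann j = -(ann j * ann i) :=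
      fun _ j _ => ann_ann_swap i j
    have hca : ∀ S : Finset (Fin n), i ∉ S → ∀ j ∈ S, cre i * ann j = -(ann j * cre i) :=
      fun S hS j hj => cre_ann_swap fun h => hS (h ▸ hj)
    have hac : ∀ S : Finset (Fin n), i ∉ S → ∀ j ∈ S, ann i * cre j = -(cre j * ann i) :=
      fun S hS j hj => ann_cre_swap fun h => hS (h ▸ hj)
    have hPe : i ∉ P.erase i := by simp
    have hQe : i ∉ Q.erase i := by simp
    have hlocal : Even ((P.erase i).card + (Q.erase i).card) →
        IsBKLocal (A.erase i) (ordProd cre (P.erase i) * ordProd ann (Q.erase i)) := fun h =>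
      Submodule.subset_span ⟨_, _, Finset.erase_subset_erase i hP,
        Finset.erase_subset_erase i hQ, h, rfl⟩
    have hzero : IsBKLocal (A.erase i) (0 : FockOp n) := Submodule.zero_mem _
    by_cases hiP : i ∈ P <;> by_cases hiQ : i ∈ Q
    · obtain ⟨c, hc⟩ := ordProd_eq_mul_erase cre_anticomm hiP
      obtain ⟨d, hd⟩ := ordProd_eq_mul_erase ann_anticomm hiQ
      have hev : Even ((P.erase i).card + (Q.erase i).card) := by
        rw [← Finset.card_erase_add_one hiP, ← Finset.card_erase_add_one hiQ] at he
        rw [Nat.even_iff] at he ⊢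
        omega
      have h1 := mul_ordProd_of_swap (hac _ hPe)
      set Y := ordProd cre (P.erase i) * ordProd ann (Q.erase i) with hY
      set e : ℂ := (-1) ^ (P.erase i).card
      have he2 : e * e = 1 := by simp [e, ← mul_pow]
      -- The sign `e` comes from moving `a_i` to the left past the product over `P \ {i}`; it is
      -- kept as a coefficient because `e * e = 1`.
      have hX : ordProd cre P * ordProd ann Q = (c * d * e) • (cre i * ann i * Y) := by
        rw [hc, hd, hY, mul_assoc (cre i) (ann i), ← mul_assoc (ann i), h1]
        simp only [Matrix.mul_smul, Matrix.smul_mul, smul_smul]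
        rw [mul_assoc (c * d), he2, mul_one, mul_comm c d]
        simp only [mul_assoc]
      have hYc : Y * cre i = cre i * Y := (hlocal hev).cre_commute (by simp) |>.symm
      have hcre : cre i * (cre i * ann i) = 0 := by rw [← mul_assoc, cre_mul_self, zero_mul]
      -- With `N = a_i† a_i`, the first term is `(1 - N) Y` because `1 - N = a_i a_i†` is
      -- idempotent; the second vanishes because `a_i† a_i† = 0`.
      have key : ann i * (cre i * ann i * Y) * cre i + cre i * (cre i * ann i * Y) * ann i
          = Y - cre i * ann i * Y := by
        have h2 : ann i * cre i = 1 - cre i * ann i := eq_sub_of_add_eq' (cre_ann_add i)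
        have h3 : ann i * (cre i * ann i * Y) * cre i = ann i * cre i * (ann i * cre i) * Y := by
          simp only [mul_assoc, hYc]
        have h4 : cre i * ann i * (cre i * ann i) = cre i * ann i := by
          rw [mul_assoc, ← mul_assoc (ann i), h2, sub_mul, one_mul, mul_assoc, ann_mul_self,
            mul_zero, sub_zero]
        rw [h3, ← mul_assoc (cre i) (cre i * ann i), hcre, h2]
        simp only [mul_sub, sub_mul, h4, mul_one, one_mul, zero_mul]
        abel
      refine ⟨(c * d * e) • Y, -((c * d * e) • Y), Submodule.smul_mem _ _ (hlocal hev),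
        Submodule.neg_mem _ (Submodule.smul_mem _ _ (hlocal hev)), ?_⟩
      rw [hX]
      simp only [Matrix.mul_smul, Matrix.smul_mul, ← smul_add, key, mul_neg, smul_sub]
      abel
    · obtain ⟨c, hc⟩ := ordProd_eq_mul_erase cre_anticomm hiP
      -- A monomial with only one of `a_i†`, `a_i` is annihilated: each of the two terms contains
      -- that operator twice.
      refine ⟨0, 0, hzero, hzero, ?_⟩
      have h1 := mul_monomial_of_swap (hcc (P.erase i)) (hca _ hiQ)
      have h2 : cre i * (ordProd cre (P.erase i) * ordProd ann Q) * cre i = 0 := by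
        rw [h1, Matrix.smul_mul, mul_assoc, cre_mul_self, mul_zero, smul_zero]
      have h3 : ordProd cre P * ordProd ann Q =
          c • (cre i * (ordProd cre (P.erase i) * ordProd ann Q)) := by
        rw [hc, Matrix.smul_mul, mul_assoc]
      rw [h3]
      simp only [Matrix.mul_smul, Matrix.smul_mul, mul_zero, add_zero]
      rw [mul_assoc (ann i), h2, ← mul_assoc (cre i) (cre i), cre_mul_self]
      simp
    · obtain ⟨d, hd⟩ := ordProd_eq_mul_erase ann_anticomm hiQ
      refine ⟨0, 0, hzero, hzero, ?_⟩
      have h1 := mul_ordProd_of_swap (hac _ hiP)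
      have h2 := mul_ordProd_of_swap (haa (Q.erase i))
      have h3 : ann i * (ordProd cre P * ordProd ann Q) = 0 := by
        rw [hd, ← mul_assoc, h1, Matrix.mul_smul, Matrix.smul_mul, mul_assoc, ← mul_assoc (ann i),
          ann_mul_self]
        simp
      have h4 : ordProd cre P * ordProd ann Q * ann i = 0 := by
        have h5 : ordProd ann Q * ann i = 0 := by
          rw [hd, h2]
          simp only [Matrix.smul_mul, mul_assoc, ann_mul_self]
          simp
        rw [mul_assoc, h5, mul_zero]
      rw [h3, mul_assoc (cre i), h4]
      simp
    · refine ⟨ordProd cre P * ordProd ann Q, 0, ?_, hzero, ?_⟩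
      · rw [Finset.erase_eq_of_notMem hiP, Finset.erase_eq_of_notMem hiQ] at hlocal
        exact hlocal he
      · have h1 := mul_monomial_of_swap (hac _ hiP) (haa Q)
        have h2 := mul_monomial_of_swap (hcc P) (hca _ hiQ)
        rw [he.neg_one_pow, one_smul] at h1 h2
        rw [h1, h2, mul_assoc _ (ann i), mul_assoc _ (cre i), ← mul_add, add_comm, cre_ann_add]
        simp

/-- An operator local to `A` that commutes with `a_i` and `a_i†` is local to `A \ {i}`. -/
theorem IsBKLocal.erase {A : Finset (Fin n)} {O : FockOp n} (hO : IsBKLocal A O) {i : Fin n}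
    (ha : ann i * O = O * ann i) (hc : cre i * O = O * cre i) : IsBKLocal (A.erase i) O := by
  obtain ⟨U, V, hU, hV, h⟩ := exists_of_local hO i
  -- On operators commuting with `a_i` and `a_i†` the map is the identity, since `a_i a_i† + a_i†
  -- a_i = 1`.
  have hOUV : O = U + cre i * ann i * V := by
    rw [← h, ha, hc, mul_assoc, mul_assoc, ← mul_add, add_comm, cre_ann_add, mul_one]
  have hUa := hU.ann_commute (b := i) (by simp)
  have hVa := hV.ann_commute (b := i) (by simp)
  have h1 : ann i * (cre i * ann i * V) = cre i * ann i * V * ann i := by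
    rw [hOUV, mul_add, add_mul, hUa] at ha
    exact add_left_cancel ha
  have h2 : cre i * ann i * V * ann i = 0 := by
    rw [mul_assoc, ← hVa, mul_assoc, ← mul_assoc (ann i), ann_mul_self, zero_mul, mul_zero]
  -- Commuting with `a_i` gives `a_i N V = N a_i V = 0` for `N = a_i† a_i`, while `a_i† a_i N V = N
  -- V`.
  have h3 : cre i * ann i * V = 0 := by
    have h4 : cre i * (ann i * (cre i * ann i * V)) = cre i * ann i * V := by
      have h5 : cre i * (ann i * (cre i * ann i * V)) =
          cre i * ((ann i * cre i) * ann i) * V := by simp only [mul_assoc]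
      rw [h5, eq_sub_of_add_eq' (cre_ann_add i), sub_mul, one_mul, mul_assoc (cre i) (ann i),
        ann_mul_self, mul_zero, sub_zero]
    rw [← h4, h1, h2, mul_zero]
  rw [hOUV, h3, add_zero]
  exact hU

/-! ### The total metric -/

theorem totalMetric_mul_cre (M : Matrix (Fin n) (Fin n) ℂ) (i : Fin n) :
    totalMetric M * cre i = (∑ j, M j i • cre j) * totalMetric M := (totalMetric_spec M).1 i

theorem ket_insert {m : Fin n} {S : Finset (Fin n)} (h : m ∉ S) :
    ∃ c : ℂ, ket (insert m S) = cre m *ᵥ (c • ket S) := by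
  refine ⟨(-1) ^ (S.filter (· < m)).card, ?_⟩
  rw [Matrix.mulVec_smul, cre_mulVec_ket, if_neg h, smul_smul, ← mul_pow]
  simp

/-- Both sides annihilate the vacuum and obey the same recursion `X a_m† = M_{i m} η - (∑ j, M_{j m}
a_j†) X`, so they agree on all basis vectors. Hermiticity of `M` is not involved. -/
theorem ann_mul_totalMetric (M : Matrix (Fin n) (Fin n) ℂ) (i : Fin n) :
    ann i * totalMetric M = totalMetric M * ∑ j, M i j • ann j := by
  apply op_ext
  intro T
  induction T using Finset.induction_on with
  | empty =>
    have h0 := (totalMetric_spec M).2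
    rw [vac] at h0
    rw [← Matrix.mulVec_mulVec, h0, ← Matrix.mulVec_mulVec, Matrix.sum_mulVec]
    simp [ann_mulVec_ket, Matrix.smul_mulVec]
  | insert m S hm ih =>
    obtain ⟨c, hc⟩ := ket_insert hm
    have hL : ann i * (∑ j, M j m • cre j) = M i m • 1 - (∑ j, M j m • cre j) * ann i := by
      rw [eq_sub_iff_add_eq, Finset.mul_sum, Finset.sum_mul, ← Finset.sum_add_distrib]
      have : ∀ j, ann i * M j m • cre j + M j m • cre j * ann i =
          if j = i then M i m • 1 else 0 := by
        intro j
        rw [Matrix.mul_smul, Matrix.smul_mul, ← smul_add, add_comm, cre_ann_anticomm]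
        split_ifs with h <;> simp [h]
      rw [Finset.sum_congr rfl fun j _ => this j]
      simp
    have hR : (∑ j, M i j • ann j) * cre m = M i m • 1 - cre m * ∑ j, M i j • ann j := by
      rw [eq_sub_iff_add_eq, Finset.mul_sum, Finset.sum_mul, ← Finset.sum_add_distrib]
      have : ∀ j, M i j • ann j * cre m + cre m * M i j • ann j =
          if j = m then M i m • 1 else 0 := by
        intro j
        rw [Matrix.mul_smul, Matrix.smul_mul, ← smul_add, add_comm, cre_ann_anticomm]
        by_cases h : j = m
        · simp [h]
        · simp [h, Ne.symm h]
      rw [Finset.sum_congr rfl fun j _ => this j]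
      simp
    have h1 : ann i * totalMetric M * cre m =
        M i m • totalMetric M - (∑ j, M j m • cre j) * (ann i * totalMetric M) := by
      rw [mul_assoc, totalMetric_mul_cre, ← mul_assoc, hL, sub_mul, Matrix.smul_mul, one_mul,
        mul_assoc]
    have h2 : totalMetric M * (∑ j, M i j • ann j) * cre m =
        M i m • totalMetric M - (∑ j, M j m • cre j) *
          (totalMetric M * ∑ j, M i j • ann j) := by
      rw [mul_assoc, hR, mul_sub, Matrix.mul_smul, mul_one, ← mul_assoc, totalMetric_mul_cre,
        mul_assoc]
    rw [hc, Matrix.mulVec_mulVec, Matrix.mulVec_mulVec, h1, h2, Matrix.mulVec_smul,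
      Matrix.mulVec_smul, Matrix.sub_mulVec, Matrix.sub_mulVec,
      ← Matrix.mulVec_mulVec _ (∑ j, M j m • cre j), ih,
      ← Matrix.mulVec_mulVec _ (∑ j, M j m • cre j)]

/-- If `N` inverts `M` on the modes in `A`, the total metrics do so on the Fock space of `A`. -/
theorem totalMetric_mul_mulVec_ket {M N : Matrix (Fin n) (Fin n) ℂ} {A : Finset (Fin n)}
    (h : ∀ a ∈ A, ∀ j, (N * M) j a = if j = a then 1 else 0) {T : Finset (Fin n)} (hT : T ⊆ A) :
    (totalMetric N * totalMetric M) *ᵥ ket T = ket T := by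
  induction T using Finset.induction_on with
  | empty =>
    have h1 := (totalMetric_spec M).2
    have h2 := (totalMetric_spec N).2
    rw [vac] at h1 h2
    rw [← Matrix.mulVec_mulVec, h1, h2]
  | insert m S hm ih =>
    obtain ⟨c, hc⟩ := ket_insert hm
    have hmA : m ∈ A := hT (by simp)
    -- Since `N M` fixes the basis vector of mode `m`, the two transformations of `a_m†` cancel.
    have h1 : totalMetric N * totalMetric M * cre m =
        cre m * (totalMetric N * totalMetric M) := by
      have h2 : ∑ j, M j m • ∑ l, N l j • cre l = cre m := by
        simp only [Finset.smul_sum, smul_smul]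
        rw [Finset.sum_comm]
        have : ∀ l, ∑ j, (M j m * N l j) • cre l = if l = m then cre m else 0 := by
          intro l
          rw [← Finset.sum_smul]
          have := h m hmA l
          rw [Matrix.mul_apply] at this
          simp only [mul_comm (M _ m), this]
          split_ifs with hl <;> simp [hl]
        simp [this]
      rw [mul_assoc, totalMetric_mul_cre, Finset.sum_mul, Finset.mul_sum]
      simp only [Matrix.smul_mul, Matrix.mul_smul, ← mul_assoc, totalMetric_mul_cre N]
      simp only [← Matrix.smul_mul, ← Finset.sum_mul, h2]
    rw [hc, Matrix.mulVec_mulVec, h1, ← Matrix.mulVec_mulVec, Matrix.mulVec_smul,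
      ih fun x hx => hT (by simp [hx])]

theorem ann_mulVec_erase {b : Fin n} {S : Finset (Fin n)} (hb : b ∈ S)
    (v : Finset (Fin n) → ℂ) :
    (ann b *ᵥ v) (S.erase b) = (-1) ^ (S.filter (· < b)).card * v S := by
  rw [Matrix.mulVec, dotProduct, Finset.sum_eq_single S]
  · simp [ann, hb]
  · intro T _ hT
    have : ¬ (b ∈ T ∧ S.erase b = T.erase b) := by
      rintro ⟨h1, h2⟩
      exact hT (by rw [← Finset.insert_erase h1, ← h2, Finset.insert_erase hb])
    simp [ann, this]
  · simp

/-- The total metric is injective on operators on the modes in `A` if the reduced metric is. -/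
theorem eq_zero_of_totalMetric_mul {M N : Matrix (Fin n) (Fin n) ℂ} {A : Finset (Fin n)}
    (h : ∀ a ∈ A, ∀ j, (N * M) j a = if j = a then 1 else 0) {X : FockOp n}
    (hc : ∀ b ∉ A, X * cre b = -(cre b * X)) (ha : ∀ b ∉ A, ann b * X = -(X * ann b))
    (hX : totalMetric M * X = 0) : X = 0 := by
  have hA : ∀ T ⊆ A, X *ᵥ ket T = 0 := by
    intro T hT
    set v := X *ᵥ ket T with hv
    -- Any `a_b` with `b ∉ A` annihilates `X|T⟩`, so `X` preserves the Fock space of `A`, where `η`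
    -- has a left inverse.
    have hsupp : ∀ S, ¬ S ⊆ A → v S = 0 := by
      intro S hS
      obtain ⟨b, hbS, hbA⟩ := Finset.not_subset.mp hS
      have h1 : ann b *ᵥ v = 0 := by
        rw [hv, Matrix.mulVec_mulVec, ha b hbA, Matrix.neg_mulVec, ← Matrix.mulVec_mulVec,
          ann_mulVec_ket, if_neg fun h => hbA (hT h)]
        simp
      have h2 := ann_mulVec_erase hbS v
      rw [h1, Pi.zero_apply, eq_comm, mul_eq_zero] at h2
      exact h2.resolve_left (pow_ne_zero _ (by norm_num))
    have hvsum : v = ∑ S, v S • ket S := by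
      ext S
      simp [ket, Finset.sum_apply, Pi.single_apply]
    have h1 : (totalMetric N * totalMetric M) *ᵥ v = v := by
      conv_lhs => rw [hvsum]
      conv_rhs => rw [hvsum]
      rw [Matrix.mulVec_sum]
      refine Finset.sum_congr rfl fun S _ => ?_
      rw [Matrix.mulVec_smul]
      by_cases hS : S ⊆ A
      · rw [totalMetric_mul_mulVec_ket h hS]
      · simp [hsupp S hS]
    rw [← h1, hv, Matrix.mulVec_mulVec, mul_assoc, hX, mul_zero, Matrix.zero_mulVec]
  -- The modes outside `A` are filled one by one, with `X` moved past each `a_b†`.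
  have hU : ∀ U T : Finset (Fin n), T ⊆ A → Disjoint U A → X *ᵥ ket (U ∪ T) = 0 := by
    intro U
    induction U using Finset.induction_on with
    | empty => intro T hT _; simpa using hA T hT
    | insert b U hb ih =>
      intro T hT hd
      rw [Finset.disjoint_insert_left] at hd
      have hbT : b ∉ U ∪ T := by
        simp only [Finset.mem_union, not_or]
        exact ⟨hb, fun h => hd.1 (hT h)⟩
      obtain ⟨c, hcc⟩ := ket_insert hbT
      rw [Finset.insert_union, hcc, Matrix.mulVec_mulVec, hc b hd.1, Matrix.neg_mulVec,
        ← Matrix.mulVec_mulVec, Matrix.mulVec_smul, ih T hT hd.2]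
      simp
  apply op_ext
  intro T
  have := hU (T \ A) (T ∩ A) Finset.inter_subset_right Finset.sdiff_disjoint
  rw [Finset.sdiff_union_inter] at this
  rw [this, Matrix.zero_mulVec]

end FreeFermion

namespace FreeFermion

variable {n : ℕ}

/-! ### From observables to one-particle vectors -/

/-- Inverting on vectors supported on `A` is all that can be asked: the metric itself may be
singular, as for two sites with `Im γ = 1`. -/
theorem exists_left_inverse_on {M : Matrix (Fin n) (Fin n) ℂ} {A : Finset (Fin n)}
    (hinj : ∀ k : Fin n → ℂ, (∀ b ∉ A, k b = 0) → M *ᵥ k = 0 → k = 0) :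
    ∃ N : Matrix (Fin n) (Fin n) ℂ, ∀ a ∈ A, ∀ j, (N * M) j a = if j = a then 1 else 0 := by
  let W : Submodule ℂ (Fin n → ℂ) :=
    { carrier := {k | ∀ b ∉ A, k b = 0}
      add_mem' := fun hx hy b hb => by simp [hx b hb, hy b hb]
      zero_mem' := fun _ _ => rfl
      smul_mem' := fun c x hx b hb => by simp [hx b hb] }
  let f : W →ₗ[ℂ] (Fin n → ℂ) := M.mulVecLin ∘ₗ W.subtype
  have hf : LinearMap.ker f = ⊥ := by
    rw [LinearMap.ker_eq_bot']
    rintro ⟨k, hk⟩ h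
    exact Subtype.ext (hinj k hk h)
  obtain ⟨g, hg⟩ := LinearMap.exists_leftInverse_of_injective f hf
  refine ⟨LinearMap.toMatrix' (W.subtype ∘ₗ g), fun a ha j => ?_⟩
  have hW : (Pi.single a 1 : Fin n → ℂ) ∈ W := fun b hb => by
    rw [Pi.single_eq_of_ne]
    rintro rfl
    exact hb ha
  have h1 := congrArg (fun φ => (φ ⟨_, hW⟩ : W).1 j) hg
  have h2 : (LinearMap.toMatrix' (W.subtype ∘ₗ g) * M) *ᵥ Pi.single a 1 =
      (g (M *ᵥ Pi.single a 1)).1 := by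
    rw [← Matrix.mulVec_mulVec, ← Matrix.toLin'_apply, Matrix.toLin'_toMatrix']
    rfl
  have h3 := congrFun h2 j
  rw [Matrix.mulVec_single_one] at h3
  refine h3.trans (h1.trans ?_)
  simp [Pi.single_apply]

/-- For an observable that is extensively local over `A`, every site of `A` is in the support of
`k` or of `M k` for a vector `k` such that both are supported on `A`. -/
theorem exists_support_of_isQuasiHermitian {M : Matrix (Fin n) (Fin n) ℂ} (hM : M.IsHermitian)
    {A : Finset (Fin n)}
    (hinj : ∀ k : Fin n → ℂ, (∀ b ∉ A, k b = 0) → M *ᵥ k = 0 → k = 0)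
    {O : FockOp n} (hO : IsBKExtensivelyLocal A O) (hq : IsQuasiHermitian (totalMetric M) O)
    {i : Fin n} (hi : i ∈ A) :
    ∃ k : Fin n → ℂ, (∀ b ∉ A, k b = 0) ∧ (∀ b ∉ A, (M *ᵥ k) b = 0) ∧
      (k i ≠ 0 ∨ (M *ᵥ k) i ≠ 0) := by
  by_contra! hcon
  obtain ⟨hloc, hext⟩ := hO
  obtain ⟨N, hN⟩ := exists_left_inverse_on hinj
  unfold IsQuasiHermitian at hq
  set η := totalMetric M
  have hcre : ∀ b ∉ A, cre b * O = O * cre b := fun b hb => hloc.cre_commute hb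
  have hann : ∀ b ∉ A, ann b * O = O * ann b := fun b hb => hloc.ann_commute hb
  -- `D φ` is the commutator of `∑ j, φ(e_j) a_j` with `O`. Linearity in `φ` lets duality act on
  -- commutators.
  let D : ((Fin n → ℂ) →ₗ[ℂ] ℂ) →ₗ[ℂ] FockOp n :=
    ∑ j, (LinearMap.applyₗ (Pi.single j 1 : Fin n → ℂ)).smulRight (ann j * O - O * ann j)
  have hD : ∀ φ, D φ = ∑ j, φ (Pi.single j 1) • (ann j * O - O * ann j) := fun φ => by
    simp [D]
  have hDproj : ∀ j, D (LinearMap.proj j) = ann j * O - O * ann j := fun j => by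
    simp [hD, Pi.single_apply]
  let row : Fin n → (Fin n → ℂ) →ₗ[ℂ] ℂ := fun b => LinearMap.proj b ∘ₗ M.mulVecLin
  have hDrow : ∀ b, D (row b) = (∑ j, M b j • ann j) * O - O * ∑ j, M b j • ann j := fun b => by
    simp [hD, row, Finset.sum_mul, Finset.mul_sum, smul_sub]
  have hDrow0 : ∀ b ∉ A, D (row b) = 0 := by
    intro b hb
    refine eq_zero_of_totalMetric_mul hN ?_ ?_ ?_
    · intro c hc
      rw [hD, Finset.sum_mul, Finset.mul_sum, ← Finset.sum_neg_distrib]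
      refine Finset.sum_congr rfl fun j _ => ?_
      -- For `j ∉ A`, in particular `j = c`, the commutator already vanishes; otherwise `a_j` and
      -- `a_c†` anticommute.
      by_cases hjA : j ∈ A
      · have hjc : j ≠ c := fun h => hc (h ▸ hjA)
        rw [Matrix.smul_mul, Matrix.mul_smul, ← smul_neg]
        congr 1
        rw [sub_mul, mul_sub, mul_assoc (ann j), ← hcre c hc, ← mul_assoc, ann_cre_swap hjc,
          mul_assoc O, ann_cre_swap hjc, mul_neg, ← mul_assoc O, ← hcre c hc, ← mul_assoc,
          ← mul_assoc]
        rw [neg_mul]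
        abel
      · simp [hann j hjA]
    · intro c hc
      rw [hD, Finset.sum_mul, Finset.mul_sum, ← Finset.sum_neg_distrib]
      refine Finset.sum_congr rfl fun j _ => ?_
      rw [Matrix.smul_mul, Matrix.mul_smul, ← smul_neg]
      congr 1
      rw [sub_mul, mul_sub, ← mul_assoc (ann c), ann_ann_swap c j, ← mul_assoc (ann c),
        hann c hc, mul_assoc O, ann_ann_swap c j, neg_mul, mul_assoc (ann j), hann c hc, mul_neg,
        mul_assoc O, mul_assoc (ann j)]
      abel
    · rw [hDrow, mul_sub, ← mul_assoc, ← mul_assoc, ← ann_mul_totalMetric, mul_assoc, hq,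
        mul_assoc Oᴴ, ← ann_mul_totalMetric, ← mul_assoc, ← mul_assoc]
      have : ann b * Oᴴ = Oᴴ * ann b := by
        have := congrArg Matrix.conjTranspose (hcre b hb)
        simpa [Matrix.conjTranspose_mul, conjTranspose_cre] using this.symm
      rw [this, sub_self]
  -- A functional vanishing on the common kernel of finitely many functionals is a combination of
  -- them.
  have hspan : ∀ φ : (Fin n → ℂ) →ₗ[ℂ] ℂ,
      (∀ k : Fin n → ℂ, (∀ b ∉ A, k b = 0) → (∀ b ∉ A, (M *ᵥ k) b = 0) → φ k = 0) →
      D φ = 0 := by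
    intro φ hφ
    let L : {b // b ∉ A} ⊕ {b // b ∉ A} → (Fin n → ℂ) →ₗ[ℂ] ℂ :=
      Sum.elim (fun b => LinearMap.proj b.1) fun b => row b.1
    have h1 : φ ∈ Submodule.span ℂ (Set.range L) := by
      apply mem_span_of_iInf_ker_le_ker
      intro k hk
      rw [Submodule.mem_iInf] at hk
      exact hφ k (fun b hb => hk (Sum.inl ⟨b, hb⟩)) fun b hb => hk (Sum.inr ⟨b, hb⟩)
    have h2 : Submodule.span ℂ (Set.range L) ≤ LinearMap.ker D := by
      rw [Submodule.span_le]
      rintro _ ⟨b | b, rfl⟩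
      · exact (hDproj b.1).trans (by rw [hann b.1 b.2, sub_self])
      · exact hDrow0 b.1 b.2
    exact h2 h1
  have h1 : ann i * O = O * ann i := by
    rw [← sub_eq_zero, ← hDproj]
    exact hspan _ fun k hk hk' => (hcon k hk hk').1
  have h2 : D (row i) = 0 := hspan _ fun k hk hk' => (hcon k hk hk').2
  have h3 : cre i * O - O * cre i = 0 := by
    refine eq_zero_of_totalMetric_mul hN ?_ ?_ ?_
    · intro c hc
      rw [sub_mul, mul_sub, mul_assoc (cre i), ← hcre c hc, ← mul_assoc, cre_cre_swap i c,
        mul_assoc O, cre_cre_swap i c, mul_neg, ← mul_assoc O, ← hcre c hc, ← mul_assoc,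
        ← mul_assoc, neg_mul]
      abel
    · intro c hc
      have hic : c ≠ i := fun h => hc (h ▸ hi)
      rw [sub_mul, mul_sub, ← mul_assoc (ann c), ann_cre_swap hic, ← mul_assoc (ann c),
        hann c hc, mul_assoc O, ann_cre_swap hic, neg_mul, mul_assoc (cre i), hann c hc, mul_neg,
        mul_assoc O, mul_assoc (cre i)]
      abel
    -- Hermiticity of `M` turns the adjoint of row `i` into column `i`, the image of `a_i†` under
    -- `η`.
    · rw [hDrow] at h2
      have h4 := congrArg Matrix.conjTranspose h2
      have h5 : (∑ j, M i j • ann j)ᴴ = ∑ j, M j i • cre j := by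
        rw [Matrix.conjTranspose_sum]
        refine Finset.sum_congr rfl fun j _ => ?_
        rw [Matrix.conjTranspose_smul, hM.apply]
        rfl
      rw [Matrix.conjTranspose_sub, Matrix.conjTranspose_mul, Matrix.conjTranspose_mul, h5,
        Matrix.conjTranspose_zero, sub_eq_zero] at h4
      rw [mul_sub, ← mul_assoc, ← mul_assoc, hq, totalMetric_mul_cre, mul_assoc, hq, mul_assoc Oᴴ,
        totalMetric_mul_cre, ← mul_assoc, ← mul_assoc, h4, sub_self]
  exact hext _ (Finset.erase_ssubset hi) (hloc.erase h1 (sub_eq_zero.mp h3))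

end FreeFermion

namespace FreeFermion

variable {n : ℕ}

/-! ### Left and right amplitudes for the farthest impurities -/

theorem farM_isHermitian (n : ℕ) (γ : ℂ) : (farM n γ).IsHermitian := by
  ext i j
  rcases lt_trichotomy i j with h | rfl | h
  · simp [farM, h.ne, h.ne', h, h.not_gt]
  · simp [farM]
  · simp [farM, h.ne, h.ne', h, h.not_gt]

/-- The entries of a vector, continued by zero. -/
noncomputable def extend (k : Fin n → ℂ) (j : ℕ) : ℂ := if h : j < n then k ⟨j, h⟩ else 0

/-- The weighted sum of the entries to the left of `i`. -/
noncomputable def leftSum (γ : ℂ) (k : Fin n → ℂ) (i : ℕ) : ℂ :=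
  ∑ j ∈ Finset.range i, γ ^ (i - j - 1) * extend k j

/-- The weighted sum of the entries to the right of `i`. -/
noncomputable def rightSum (γ : ℂ) (k : Fin n → ℂ) (i : ℕ) : ℂ :=
  ∑ m ∈ Finset.range n, conj γ ^ m * extend k (i + 1 + m)

theorem extend_val (k : Fin n → ℂ) (i : Fin n) : extend k i = k i := by simp [extend]

theorem extend_of_le (k : Fin n → ℂ) {j : ℕ} (h : n ≤ j) : extend k j = 0 := by
  simp [extend, h.not_gt]

theorem leftSum_zero (γ : ℂ) (k : Fin n → ℂ) : leftSum γ k 0 = 0 := by simp [leftSum]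

theorem leftSum_succ (γ : ℂ) (k : Fin n → ℂ) (i : ℕ) :
    leftSum γ k (i + 1) = γ * leftSum γ k i + extend k i := by
  rw [leftSum, Finset.sum_range_succ, leftSum, Finset.mul_sum]
  congr 1
  · refine Finset.sum_congr rfl fun j hj => ?_
    have := Finset.mem_range.mp hj
    rw [← mul_assoc, ← pow_succ']
    congr 2
    omega
  · simp

theorem rightSum_eq (γ : ℂ) (k : Fin n → ℂ) (i : ℕ) :
    rightSum γ k i = extend k (i + 1) + conj γ * rightSum γ k (i + 1) := by
  -- The number of terms in `rightSum` does not depend on `i`; the surplus ones vanish because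
  -- `extend` is zero from `n` on.
  have h := Finset.sum_range_succ' (fun m => conj γ ^ m * extend k (i + 1 + m)) n
  rw [Finset.sum_range_succ, extend_of_le k (by omega : n ≤ i + 1 + n), mul_zero, add_zero] at h
  rw [rightSum, h, rightSum, Finset.mul_sum, add_comm]
  congr 1
  · simp
  · refine Finset.sum_congr rfl fun j _ => ?_
    rw [← mul_assoc, ← pow_succ', add_right_comm (i + 1) 1 j, add_assoc (i + 1) j 1]

theorem rightSum_of_le (γ : ℂ) (k : Fin n → ℂ) {i : ℕ} (h : n ≤ i + 1) : rightSum γ k i = 0 :=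
  Finset.sum_eq_zero fun m _ => by rw [extend_of_le k (by omega), mul_zero]

theorem farM_mulVec (γ : ℂ) (k : Fin n → ℂ) (i : Fin n) :
    (farM n γ *ᵥ k) i = extend k i +
      Complex.I * γ.im * (leftSum γ k i - rightSum γ k i) := by
  obtain ⟨m, hm⟩ : ∃ m, n = i + 1 + m := ⟨n - (i + 1), by omega⟩
  set g : ℕ → ℂ := fun j => (if i.val = j then 1
    else if i.val < j then -Complex.I * (γ.im : ℂ) * (conj γ) ^ (j - i.val - 1)
    else Complex.I * (γ.im : ℂ) * γ ^ (i.val - j - 1)) * extend k j with hg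
  have h1 : (farM n γ *ᵥ k) i = ∑ j ∈ Finset.range n, g j := by
    rw [← Fin.sum_univ_eq_sum_range, Matrix.mulVec, dotProduct]
    refine Finset.sum_congr rfl fun j _ => ?_
    simp only [hg, farM, Matrix.of_apply, extend_val, Fin.ext_iff, Fin.lt_def]
  have h2 : ∑ j ∈ Finset.range n, g j = ∑ j ∈ Finset.range (i + 1 + m), g j :=
    congrArg (fun N => ∑ j ∈ Finset.range N, g j) hm
  have h3 : rightSum γ k i = ∑ l ∈ Finset.range m, conj γ ^ l * extend k (i + 1 + l) := by
    have : rightSum γ k i =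
        ∑ l ∈ Finset.range (m + (i + 1)), conj γ ^ l * extend k (i + 1 + l) :=
      congrArg (fun N => ∑ l ∈ Finset.range N, conj γ ^ l * extend k (i + 1 + l))
        (hm.trans (add_comm _ _))
    rw [this, Finset.sum_range_add]
    refine (add_eq_left).mpr (Finset.sum_eq_zero fun l _ => ?_)
    rw [extend_of_le k (by omega), mul_zero]
  have h4 : ∑ j ∈ Finset.range i, g j = Complex.I * γ.im * leftSum γ k i := by
    rw [leftSum, Finset.mul_sum]
    refine Finset.sum_congr rfl fun j hj => ?_
    have hj := Finset.mem_range.mp hj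
    simp only [hg]
    rw [if_neg (by omega), if_neg (by omega), mul_assoc]
  have h5 : ∑ l ∈ Finset.range m, g (i + 1 + l) = -(Complex.I * γ.im * rightSum γ k i) := by
    rw [h3, Finset.mul_sum, ← Finset.sum_neg_distrib]
    refine Finset.sum_congr rfl fun l hl => ?_
    simp only [hg]
    rw [if_neg (by omega), if_pos (by omega), show i.val + 1 + l - i - 1 = l by omega]
    ring
  rw [h1, h2, Finset.sum_range_add, Finset.sum_range_succ, h4, h5]
  simp only [hg, if_true]
  ring

/-- The vectors on which a site of `A` has to be visible: supported on `A`, with image supported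
on `A`. -/
structure IsSupported (γ : ℂ) (A : Finset (Fin n)) (k : Fin n → ℂ) : Prop where
  left : ∀ b ∉ A, k b = 0
  right : ∀ b ∉ A, (farM n γ *ᵥ k) b = 0

/-- Together with the next two bounds, this is how `‖γ‖ ≠ 1` enters: the recursions return a
multiple of the initial amplitude with factor `|γ|²`, `-γ²` or `-γ*²`. -/
theorem one_ne_conj_mul {γ : ℂ} (hγ : ‖γ‖ ≠ 1) : conj γ * γ ≠ 1 := by
  rw [Complex.conj_mul']
  norm_cast
  rw [pow_eq_one_iff_of_nonneg (norm_nonneg γ) two_ne_zero]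
  exact hγ

theorem one_add_sq_ne_zero {γ : ℂ} (hγ : ‖γ‖ ≠ 1) : 1 + γ ^ 2 ≠ 0 := by
  intro h
  have h1 : ‖γ‖ ^ 2 = 1 := by
    rw [← norm_pow, eq_neg_of_add_eq_zero_right h]
    simp
  rw [pow_eq_one_iff_of_nonneg (norm_nonneg γ) two_ne_zero] at h1
  exact hγ h1

theorem one_add_conj_sq_ne_zero {γ : ℂ} (hγ : ‖γ‖ ≠ 1) : 1 + conj γ ^ 2 ≠ 0 :=
  one_add_sq_ne_zero (by rwa [Complex.norm_conj])

namespace IsSupported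

variable {γ : ℂ} {A : Finset (Fin n)} {k : Fin n → ℂ}

theorem extend_eq_zero (hk : IsSupported γ A k) {b : Fin n} (hb : b ∉ A) :
    extend k b = 0 := by rw [extend_val, hk.left b hb]

theorem leftSum_eq_rightSum (him : γ.im ≠ 0) (hk : IsSupported γ A k) {b : Fin n} (hb : b ∉ A) :
    leftSum γ k b = rightSum γ k b := by
  have h := hk.right b hb
  rw [farM_mulVec, hk.extend_eq_zero hb, zero_add, mul_eq_zero] at h
  exact sub_eq_zero.mp (h.resolve_left (by simpa using him))

/-- Two adjacent sites outside `A` decouple the two sides. -/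
theorem leftSum_eq_zero_of_gap (him : γ.im ≠ 0) (hγ : ‖γ‖ ≠ 1) (hk : IsSupported γ A k)
    {b c : Fin n} (hb : b ∉ A) (hc : c ∉ A) (hbc : c.val = b.val + 1) :
    leftSum γ k b = 0 ∧ leftSum γ k c = 0 := by
  have h1 := hk.leftSum_eq_rightSum him hb
  have h2 := hk.leftSum_eq_rightSum him hc
  have h3 := hk.extend_eq_zero hb
  have h4 := hk.extend_eq_zero hc
  have h5 := leftSum_succ γ k b
  have h6 := rightSum_eq γ k b
  rw [← hbc] at h5 h6
  -- Going around the gap, `L_b = R_b = γ* R_c = γ* L_c = |γ|² L_b`.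
  have h7 : leftSum γ k b * (conj γ * γ - 1) = 0 := by
    linear_combination (-1 : ℂ) * h1 - h6 - h4 - conj γ * h3 - conj γ * h5 + conj γ * h2
  have h8 := (mul_eq_zero.mp h7).resolve_right (sub_ne_zero.mpr (one_ne_conj_mul hγ))
  refine ⟨h8, ?_⟩
  rw [h5, h8, h3]
  simp

/-- The vector and its image vanish on a single site without incoming amplitudes from the left. -/
theorem single_of_left (him : γ.im ≠ 0) (hγ : ‖γ‖ ≠ 1) (hk : IsSupported γ A k) {i : Fin n}
    (hpos : i.val ≠ 0) (hl : ∀ b : Fin n, b.val + 1 = i.val → b ∉ A ∧ leftSum γ k b = 0)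
    (hr : ∀ b : Fin n, b.val = i.val + 1 → b ∉ A) : k i = 0 ∧ (farM n γ *ᵥ k) i = 0 := by
  obtain ⟨b, hb⟩ : ∃ b : Fin n, b.val + 1 = i.val := ⟨⟨i.val - 1, by omega⟩, by simp; omega⟩
  obtain ⟨hbA, hL⟩ := hl b hb
  have h1 := hk.leftSum_eq_rightSum him hbA
  have h2 := rightSum_eq γ k b
  have h3 := leftSum_succ γ k b
  rw [hb] at h2 h3
  rw [hL, hk.extend_eq_zero hbA, mul_zero, add_zero] at h3
  rw [← h1, hL] at h2
  have key : extend k i = 0 ∧ rightSum γ k i = 0 := by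
    by_cases hn : i.val + 1 < n
    · have hc := hr ⟨i.val + 1, hn⟩ rfl
      have h4 := hk.leftSum_eq_rightSum him hc
      have h5 := hk.extend_eq_zero hc
      have h6 := leftSum_succ γ k i
      have h7 := rightSum_eq γ k i
      simp only at h4 h5
      -- Here `0 = R_b = k_i + γ* R_i` and `R_i = γ* R_c = γ* L_c = γ* k_i`.
      have h8 : extend k i * (1 + conj γ ^ 2) = 0 := by
        linear_combination (-1 : ℂ) * h2 - conj γ * h7 - conj γ * h5 + conj γ ^ 2 * h4
          - conj γ ^ 2 * h6 - conj γ ^ 2 * γ * h3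
      have h9 := (mul_eq_zero.mp h8).resolve_right (one_add_conj_sq_ne_zero hγ)
      refine ⟨h9, ?_⟩
      rw [h7, h5, ← h4, h6, h3, h9]
      simp
    · have h4 := rightSum_of_le γ k (i := i) (by omega)
      rw [h4, mul_zero, add_zero] at h2
      exact ⟨h2.symm, h4⟩
  rw [farM_mulVec, ← extend_val k, key.1, key.2, h3]
  simp

/-- The mirror image of `single_of_left`. -/
theorem single_of_right (him : γ.im ≠ 0) (hγ : ‖γ‖ ≠ 1) (hk : IsSupported γ A k) {i : Fin n}
    (hpos : i.val + 1 ≠ n) (hl : ∀ b : Fin n, b.val + 1 = i.val → b ∉ A)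
    (hr : ∀ b : Fin n, b.val = i.val + 1 → b ∉ A ∧ leftSum γ k b = 0) :
    k i = 0 ∧ (farM n γ *ᵥ k) i = 0 := by
  obtain ⟨c, hc⟩ : ∃ c : Fin n, c.val = i.val + 1 := ⟨⟨i.val + 1, by omega⟩, rfl⟩
  obtain ⟨hcA, hL⟩ := hr c hc
  have h1 := hk.leftSum_eq_rightSum him hcA
  have h2 := rightSum_eq γ k i
  have h3 := leftSum_succ γ k i
  rw [← hc] at h2 h3
  rw [← h1, hL, hk.extend_eq_zero hcA, mul_zero, add_zero] at h2
  rw [hL] at h3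
  have key : extend k i = 0 ∧ leftSum γ k i = 0 := by
    by_cases hn : i.val = 0
    · have h4 : leftSum γ k i = 0 := by rw [hn, leftSum_zero]
      rw [h4, mul_zero, zero_add] at h3
      exact ⟨h3.symm, h4⟩
    · obtain ⟨b, hb⟩ : ∃ b : Fin n, b.val + 1 = i.val := ⟨⟨i.val - 1, by omega⟩, by simp; omega⟩
      have hbA := hl b hb
      have h4 := hk.leftSum_eq_rightSum him hbA
      have h5 := hk.extend_eq_zero hbA
      have h6 := leftSum_succ γ k b
      have h7 := rightSum_eq γ k b
      rw [hb] at h6 h7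
      have h8 : extend k i * (1 + γ ^ 2) = 0 := by
        linear_combination (-1 : ℂ) * h3 - γ * h6 - γ * h5 - γ ^ 2 * h4
          - γ ^ 2 * h7 - γ ^ 2 * conj γ * h2
      have h9 := (mul_eq_zero.mp h8).resolve_right (one_add_sq_ne_zero hγ)
      refine ⟨h9, ?_⟩
      rw [h6, h5, h4, h7, h2, h9]
      simp
  rw [farM_mulVec, ← extend_val k, key.1, key.2, h2]
  simp

/-- The vector and its image vanish on a pair of sites without incoming amplitudes. -/
theorem pair (him : γ.im ≠ 0) (hγ : ‖γ‖ ≠ 1) (hk : IsSupported γ A k) {b p q c : Fin n}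
    (hp : p.val = b.val + 1) (hq : q.val = p.val + 1) (hc : c.val = q.val + 1)
    (hbA : b ∉ A) (hcA : c ∉ A) (hb0 : leftSum γ k b = 0) (hc0 : leftSum γ k c = 0) :
    k p = 0 ∧ (farM n γ *ᵥ k) p = 0 := by
  have h1 := hk.leftSum_eq_rightSum him hbA
  have h2 := hk.leftSum_eq_rightSum him hcA
  have h3 := leftSum_succ γ k b
  have h4 := leftSum_succ γ k p
  have h5 := leftSum_succ γ k q
  have h6 := rightSum_eq γ k b
  have h7 := rightSum_eq γ k p
  have h8 := rightSum_eq γ k q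
  rw [← hp] at h3 h6
  rw [← hq] at h4 h7
  rw [← hc] at h5 h8
  rw [hb0, hk.extend_eq_zero hbA, mul_zero, add_zero] at h3
  rw [← h2, hc0, hk.extend_eq_zero hcA, mul_zero, add_zero] at h8
  rw [h8, mul_zero, add_zero] at h7
  rw [h3, mul_zero, zero_add] at h4
  rw [h4, hc0] at h5
  rw [← h1, hb0, h7] at h6
  -- The conditions at `c` and `b` read `γ k_p + k_q = 0` and `k_p + γ* k_q = 0`.
  have h9 : extend k p * (conj γ * γ - 1) = 0 := by
    linear_combination h6 - conj γ * h5
  have h10 := (mul_eq_zero.mp h9).resolve_right (sub_ne_zero.mpr (one_ne_conj_mul hγ))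
  rw [h10, mul_zero, zero_add] at h5
  rw [farM_mulVec, ← extend_val k, h3, h7, h10, ← h5]
  simp

end IsSupported

/-- The reduced metric is injective on vectors that vanish at some site. -/
theorem farM_mulVec_eq_zero {γ : ℂ} (him : γ.im ≠ 0) (hγ : ‖γ‖ ≠ 1) {k : Fin n → ℂ}
    (h0 : farM n γ *ᵥ k = 0) {b : Fin n} (hb : k b = 0) : k = 0 := by
  set L := leftSum γ k with hL
  set R := rightSum γ k with hR
  set y : ℂ := Complex.I * γ.im with hy
  have hy0 : y ≠ 0 := by simpa [hy] using him
  have hre : γ = γ.re + y := by rw [hy, mul_comm]; exact (Complex.re_add_im γ).symm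
  have hconj : conj γ = γ.re - y := by
    apply Complex.ext <;> simp [hy]
  have hyc : conj y = -y := by simp [hy]
  have hκ : ∀ i < n, extend k i = y * (R i - L i) := by
    intro i hi
    have := congrFun h0 ⟨i, hi⟩
    rw [farM_mulVec] at this
    simp only [Pi.zero_apply] at this
    linear_combination this
  -- Eliminating `k = y (R - L)` leaves a transfer recursion in `L` and `R` alone.
  have hup : ∀ i < n, L (i + 1) = γ.re * L i + y * R i := by
    intro i hi
    linear_combination leftSum_succ γ k i + hκ i hi + L i * hre
  have hdown : ∀ i, i + 1 < n → R i = γ.re * R (i + 1) - y * L (i + 1) := by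
    intro i hi
    linear_combination rightSum_eq γ k i + hκ (i + 1) hi + R (i + 1) * hconj
  have hall : (∀ i < n, L i = 0 ∧ R i = 0) → k = 0 := by
    intro h
    ext i
    rw [← extend_val k, hκ i i.2, (h i i.2).1, (h i i.2).2]
    simp
  have hLR : L b = R b := by
    have h1 := hκ b b.2
    rw [extend_val, hb, eq_comm, mul_eq_zero, sub_eq_zero] at h1
    exact (h1.resolve_left hy0).symm
  apply hall
  -- If `Re γ = 0`, then `R_i = -y L_{i+1} = -y² R_i = |γ|² R_i`, so everything vanishes without
  -- using the site `b`.
  by_cases hx : γ.re = 0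
  · have hRz : ∀ i < n, R i = 0 := by
      intro i hi
      by_cases hi1 : i + 1 < n
      · have h1 := hup i hi
        have h2 := hdown i hi1
        have h3 : R i * (conj γ * γ - 1) = 0 := by
          rw [hconj]
          rw [hx] at h1 h2 ⊢
          have hre' : γ = y := by rw [hre, hx]; simp
          rw [hre']
          push_cast at *
          linear_combination y * h1 - h2
        exact (mul_eq_zero.mp h3).resolve_right (sub_ne_zero.mpr (one_ne_conj_mul hγ))
      · exact rightSum_of_le γ k (by omega)
    intro i hi
    refine ⟨?_, hRz i hi⟩
    cases i with
    | zero => exact leftSum_zero γ k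
    | succ i => rw [hup i (by omega), hRz i (by omega), hx]; simp
  · have hx' : (γ.re : ℂ) ≠ 0 := by exact_mod_cast hx
    -- The real part of `L conj(R)` is conserved, as `y` is imaginary, and it is zero at the left
    -- end. At `b`, where `L = R`, it equals `|L|²`; the resulting zero propagates both ways.
    have hinv : ∀ i < n, L i * conj (R i) + conj (L i) * R i = 0 := by
      intro i
      induction i with
      | zero => intro _; simp [hL, leftSum_zero]
      | succ i ih =>
        intro hi
        have h1 := hup i (by omega)
        have h2 := hdown i hi
        have h1c := congrArg conj h1
        have h2c := congrArg conj h2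
        simp only [map_add, map_sub, map_mul, hyc, Complex.conj_ofReal] at h1c h2c
        have h3 : (γ.re : ℂ) * (L (i + 1) * conj (R (i + 1)) + conj (L (i + 1)) * R (i + 1)) = 0 := by
          linear_combination (γ.re : ℂ) * ih (by omega) + conj (R i) * h1 + R i * h1c
            - L (i + 1) * h2c - conj (L (i + 1)) * h2
        exact (mul_eq_zero.mp h3).resolve_left hx'
    have hRb : R b = 0 := by
      have h1 := hinv b b.2
      rw [hLR, mul_comm (conj _), ← two_mul, Complex.mul_conj] at h1
      simpa using h1
    have hLb : L b = 0 := hLR.trans hRb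
    intro i
    rcases le_total b.val i with h | h
    · induction i, h using Nat.le_induction with
      | base => exact fun _ => ⟨hLb, hRb⟩
      | succ i _ ih =>
        intro hi
        obtain ⟨h1, h2⟩ := ih (by omega)
        have h3 : L (i + 1) = 0 := by rw [hup i (by omega), h1, h2]; simp
        have h4 := hdown i hi
        rw [h2, h3, mul_zero, sub_zero, eq_comm, mul_eq_zero] at h4
        exact ⟨h3, h4.resolve_left hx'⟩
    · intro _
      induction h using Nat.decreasingInduction with
      | self => exact ⟨hLb, hRb⟩
      | of_succ i hi ih =>
        obtain ⟨h1, h2⟩ := ih (by omega)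
        have h3 : R i = 0 := by rw [hdown i (by omega), h1, h2]; simp
        have h4 := hup i (by omega)
        rw [h1, h3, mul_zero, add_zero, eq_comm, mul_eq_zero] at h4
        exact ⟨h4.resolve_left hx', h3⟩

end FreeFermion

namespace FreeFermion

variable {n : ℕ} {A C D : Finset (Fin n)}

/-! ### Components and the visibility of their sites -/

theorem subGraph_adj {x y : (A : Set (Fin n))} :
    (subGraph A).Adj x y ↔ x.1.val + 1 = y.1.val ∨ y.1.val + 1 = x.1.val := by
  simp [subGraph, SimpleGraph.pathGraph_adj]

theorem IsComponent.subset (h : IsComponent A C) : C ⊆ A := by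
  obtain ⟨c, hc⟩ := h
  intro x hx
  have : x ∈ (C : Set (Fin n)) := hx
  rw [hc] at this
  obtain ⟨y, -, rfl⟩ := this
  exact y.2

theorem IsComponent.nonempty (h : IsComponent A C) : C.Nonempty := by
  obtain ⟨c, hc⟩ := h
  rw [← Finset.coe_nonempty, hc]
  exact c.nonempty_supp.image _

theorem IsComponent.mem_of_adj (h : IsComponent A C) {x y : Fin n} (hx : x ∈ C) (hy : y ∈ A)
    (hxy : x.val + 1 = y.val ∨ y.val + 1 = x.val) : y ∈ C := by
  obtain ⟨c, hc⟩ := h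
  have h1 : x ∈ (C : Set (Fin n)) := hx
  rw [hc] at h1
  obtain ⟨x, hxc, rfl⟩ := h1
  have h2 : (subGraph A).Adj x ⟨y, hy⟩ := subGraph_adj.mpr hxy
  have h3 : y ∈ (C : Set (Fin n)) := by
    rw [hc]
    exact ⟨⟨y, hy⟩, (c.mem_supp_congr_adj h2).mp hxc, rfl⟩
  exact h3

theorem exists_isComponent {x : Fin n} (hx : x ∈ A) : ∃ D, IsComponent A D ∧ x ∈ D := by
  classical
  let c := (subGraph A).connectedComponentMk ⟨x, hx⟩
  refine ⟨(Subtype.val '' c.supp).toFinite.toFinset, ⟨c, by simp⟩, ?_⟩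
  rw [Set.Finite.mem_toFinset]
  exact ⟨⟨x, hx⟩, rfl, rfl⟩

theorem IsComponent.eq_of_mem (hC : IsComponent A C) (hD : IsComponent A D) {x : Fin n}
    (hxC : x ∈ C) (hxD : x ∈ D) : C = D := by
  obtain ⟨c, hc⟩ := hC
  obtain ⟨d, hd⟩ := hD
  have h1 : x ∈ (C : Set (Fin n)) := hxC
  have h2 : x ∈ (D : Set (Fin n)) := hxD
  rw [hc] at h1
  rw [hd] at h2
  obtain ⟨y, hy, hyx⟩ := h1
  obtain ⟨z, hz, hzx⟩ := h2
  have hyz : y = z := Subtype.ext (hyx.trans hzx.symm)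
  rw [SimpleGraph.ConnectedComponent.mem_supp_iff] at hy hz
  apply Finset.coe_injective
  rw [hc, hd, ← hy, ← hz, hyz]

/-- A component with two sites is a pair of neighbours. -/
theorem IsComponent.eq_pair (h : IsComponent A C) (hcard : C.card = 2) :
    ∃ p q : Fin n, q.val = p.val + 1 ∧ C = {p, q} := by
  obtain ⟨x, y, hxy, rfl⟩ := Finset.card_eq_two.mp hcard
  have hadj : x.val + 1 = y.val ∨ y.val + 1 = x.val := by
    have hxA := h.subset (by simp : x ∈ ({x, y} : Finset (Fin n)))
    have hyA := h.subset (by simp : y ∈ ({x, y} : Finset (Fin n)))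
    have h' := h
    obtain ⟨c, hc⟩ := h'
    have hmem : ∀ z (hz : z ∈ A), z ∈ ({x, y} : Finset (Fin n)) →
        (subGraph A).connectedComponentMk ⟨z, hz⟩ = c := by
      intro z hz hzC
      have h1 : z ∈ ((({x, y} : Finset (Fin n))) : Set (Fin n)) := hzC
      rw [hc] at h1
      obtain ⟨w, hw, rfl⟩ := h1
      exact hw
    have hr : (subGraph A).Reachable ⟨x, hxA⟩ ⟨y, hyA⟩ :=
      SimpleGraph.ConnectedComponent.exact
        ((hmem x hxA (by simp)).trans (hmem y hyA (by simp)).symm)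
    obtain ⟨w⟩ := hr
    -- The first step of a walk from `x` to `y` stays in the component, so it ends at `y`.
    cases w with
    | nil => exact absurd rfl hxy
    | @cons _ v _ hv _ =>
      have hv' : x.val + 1 = v.1.val ∨ v.1.val + 1 = x.val := subGraph_adj.mp hv
      have h1 := h.mem_of_adj (by simp) v.2 hv'
      rw [Finset.mem_insert, Finset.mem_singleton] at h1
      rcases h1 with h1 | h1
      · rw [h1] at hv'
        omega
      · rwa [h1] at hv'
  rcases hadj with h1 | h1
  · exact ⟨x, y, h1.symm, rfl⟩
  · exact ⟨y, x, h1.symm, Finset.pair_comm x y⟩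

theorem setDist_le_two {x y : Fin n} (hx : x ∈ C) (hy : y ∈ D)
    (h : x.val = y.val + 2 ∨ y.val = x.val + 2) : setDist C D ≤ 2 := by
  have hmem : (SimpleGraph.pathGraph n).dist x y ∈
      {d : ℕ | ∃ i ∈ C, ∃ j ∈ D, d = (SimpleGraph.pathGraph n).dist i j} := ⟨x, hx, y, hy, rfl⟩
  refine (Nat.sInf_le hmem).trans ?_
  have key : ∀ u w : Fin n, w.val = u.val + 2 → (SimpleGraph.pathGraph n).dist u w ≤ 2 := by
    intro u w huw
    let v : Fin n := ⟨u.val + 1, by omega⟩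
    have h1 : (SimpleGraph.pathGraph n).Adj u v := by simp [SimpleGraph.pathGraph_adj, v]
    have h2 : (SimpleGraph.pathGraph n).Adj v w := by
      simp only [SimpleGraph.pathGraph_adj, v]
      omega
    exact SimpleGraph.dist_le (.cons h1 (.cons h2 .nil))
  rcases h with h | h
  · rw [SimpleGraph.dist_comm]
    exact key y x h
  · exact key x y h

theorem IsComponent.notMem_of_adj_singleton {i : Fin n} (hC : IsComponent A {i}) {b : Fin n}
    (h : i.val + 1 = b.val ∨ b.val + 1 = i.val) : b ∉ A := by
  intro hb
  have := hC.mem_of_adj (by simp) hb h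
  rw [Finset.mem_singleton] at this
  subst this
  omega

/-- The site `b` outside `A` supplies the zero of `k` that makes the metric injective on vectors
supported on `A`. -/
theorem exists_isSupported {γ : ℂ} (him : γ.im ≠ 0) (hγ : ‖γ‖ ≠ 1)
    (hA : ∃ O : FockOp n, IsBKExtensivelyLocal A O ∧
      IsQuasiHermitian (totalMetric (farM n γ)) O)
    {b i : Fin n} (hb : b ∉ A) (hi : i ∈ A) :
    ∃ k, IsSupported γ A k ∧ ¬ (k i = 0 ∧ (farM n γ *ᵥ k) i = 0) := by
  obtain ⟨O, hO, hq⟩ := hA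
  obtain ⟨k, h1, h2, h3⟩ := exists_support_of_isQuasiHermitian (farM_isHermitian n γ)
    (fun k hk h0 => farM_mulVec_eq_zero him hγ h0 (hk b hb)) hO hq hi
  exact ⟨k, ⟨h1, h2⟩, by tauto⟩

/-- To the left of a single-site component the amplitudes do not vanish. -/
theorem singleton_left {γ : ℂ} (him : γ.im ≠ 0) (hγ : ‖γ‖ ≠ 1)
    (hA : ∃ O : FockOp n, IsBKExtensivelyLocal A O ∧
      IsQuasiHermitian (totalMetric (farM n γ)) O)
    {i : Fin n} (hC : IsComponent A {i}) {b : Fin n}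
    (hb : b.val + 1 = i.val) : ∃ k, IsSupported γ A k ∧ leftSum γ k b ≠ 0 := by
  have hbA := hC.notMem_of_adj_singleton (Or.inr hb)
  obtain ⟨k, hk, hne⟩ := exists_isSupported him hγ hA hbA (hC.subset (by simp : i ∈ {i}))
  refine ⟨k, hk, fun h0 => hne (hk.single_of_left him hγ (by omega) ?_ ?_)⟩
  · intro c hc
    obtain rfl : c = b := Fin.ext (by omega)
    exact ⟨hbA, h0⟩
  · exact fun c hc => hC.notMem_of_adj_singleton (Or.inl hc.symm)

/-- To the right of a single-site component the amplitudes do not vanish. -/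
theorem singleton_right {γ : ℂ} (him : γ.im ≠ 0) (hγ : ‖γ‖ ≠ 1)
    (hA : ∃ O : FockOp n, IsBKExtensivelyLocal A O ∧
      IsQuasiHermitian (totalMetric (farM n γ)) O)
    {i : Fin n} (hC : IsComponent A {i}) {b : Fin n}
    (hb : b.val = i.val + 1) : ∃ k, IsSupported γ A k ∧ leftSum γ k b ≠ 0 := by
  have hbA := hC.notMem_of_adj_singleton (Or.inl hb.symm)
  obtain ⟨k, hk, hne⟩ := exists_isSupported him hγ hA hbA (hC.subset (by simp : i ∈ {i}))
  refine ⟨k, hk, fun h0 => hne (hk.single_of_right him hγ (by omega) ?_ ?_)⟩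
  · exact fun c hc => hC.notMem_of_adj_singleton (Or.inr hc)
  · intro c hc
    obtain rfl : c = b := Fin.ext (by omega)
    exact ⟨hbA, h0⟩

/-- Otherwise `j` and the site between `j` and `i` form a gap, which kills the amplitude next to
`i`. -/
theorem mem_of_singleton {γ : ℂ} (him : γ.im ≠ 0) (hγ : ‖γ‖ ≠ 1)
    (hA : ∃ O : FockOp n, IsBKExtensivelyLocal A O ∧
      IsQuasiHermitian (totalMetric (farM n γ)) O)
    {i : Fin n} (hC : IsComponent A {i}) {j : Fin n}
    (hj : j.val + 2 = i.val ∨ j.val = i.val + 2) : j ∈ A := by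
  by_contra hjA
  rcases hj with hj | hj
  · let b : Fin n := ⟨j.val + 1, by omega⟩
    have hb : b.val + 1 = i.val := by simp only [b]; omega
    obtain ⟨k, hk, hne⟩ := singleton_left him hγ hA hC hb
    exact hne (hk.leftSum_eq_zero_of_gap him hγ hjA
      (hC.notMem_of_adj_singleton (Or.inr hb)) rfl).2
  · let b : Fin n := ⟨i.val + 1, by omega⟩
    obtain ⟨k, hk, hne⟩ := singleton_right him hγ hA hC (b := b) rfl
    exact hne (hk.leftSum_eq_zero_of_gap him hγ
      (hC.notMem_of_adj_singleton (Or.inl rfl)) hjA hj).1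

/-- If the left neighbour is the first site, its left sum is empty; otherwise the site two to the
left belongs to `A` and contradicts minimality. -/
theorem singleton_leftmost {γ : ℂ} (him : γ.im ≠ 0) (hγ : ‖γ‖ ≠ 1)
    (hA : ∃ O : FockOp n, IsBKExtensivelyLocal A O ∧
      IsQuasiHermitian (totalMetric (farM n γ)) O)
    {i : Fin n} (hC : IsComponent A {i}) (hmin : ∀ j ∈ A, i ≤ j) :
    i.val = 0 := by
  by_contra h0
  let b : Fin n := ⟨i.val - 1, by omega⟩
  have hb : b.val + 1 = i.val := by simp only [b]; omega
  obtain ⟨k, hk, hne⟩ := singleton_left him hγ hA hC hb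
  by_cases h1 : b.val = 0
  · exact hne (by rw [h1, leftSum_zero])
  · have h2 := mem_of_singleton him hγ hA hC (j := ⟨i.val - 2, by omega⟩)
      (Or.inl (by simp only; omega))
    have := Fin.le_def.mp (hmin _ h2)
    simp only at this
    omega

theorem singleton_rightmost {γ : ℂ} (him : γ.im ≠ 0) (hγ : ‖γ‖ ≠ 1)
    (hA : ∃ O : FockOp n, IsBKExtensivelyLocal A O ∧
      IsQuasiHermitian (totalMetric (farM n γ)) O)
    {i : Fin n} (hC : IsComponent A {i}) (hmax : ∀ j ∈ A, j ≤ i) :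
    i.val + 1 = n := by
  by_contra h0
  let b : Fin n := ⟨i.val + 1, by omega⟩
  obtain ⟨k, hk, hne⟩ := singleton_right him hγ hA hC (b := b) rfl
  by_cases h1 : b.val + 1 = n
  · have hbA := hC.notMem_of_adj_singleton (b := b) (Or.inl rfl)
    exact hne ((hk.leftSum_eq_rightSum him hbA).trans (rightSum_of_le γ k h1.ge))
  · have hb : b.val = i.val + 1 := rfl
    have h2 := mem_of_singleton him hγ hA hC (j := ⟨i.val + 2, by omega⟩) (Or.inr rfl)
    have := Fin.le_def.mp (hmax _ h2)
    simp only at this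
    omega

/-- With no component this close, each side of the pair has a two-site gap or a single site before
the end of the chain. Either way the amplitudes next to the pair vanish and `p` is invisible. -/
theorem exists_component_near_pair {γ : ℂ} (him : γ.im ≠ 0) (hγ : ‖γ‖ ≠ 1)
    (hA : ∃ O : FockOp n, IsBKExtensivelyLocal A O ∧
      IsQuasiHermitian (totalMetric (farM n γ)) O)
    {p q : Fin n} (hpq : q.val = p.val + 1)
    (hC : IsComponent A {p, q}) (hp : p.val ≠ 0) (hq : q.val + 1 ≠ n) :
    ∃ D, IsComponent A D ∧ D ≠ {p, q} ∧ setDist {p, q} D ≤ 2 := by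
  by_contra! hcon
  let b : Fin n := ⟨p.val - 1, by omega⟩
  let c : Fin n := ⟨q.val + 1, by omega⟩
  have hb : p.val = b.val + 1 := by simp only [b]; omega
  have hc : c.val = q.val + 1 := rfl
  have hnear : ∀ x ∈ ({p, q} : Finset (Fin n)), ∀ y ∉ ({p, q} : Finset (Fin n)),
      (x.val = y.val + 2 ∨ y.val = x.val + 2) → y ∉ A := by
    intro x hx y hy hxy hyA
    obtain ⟨D, hD, hyD⟩ := exists_isComponent hyA
    have := hcon D hD (fun h => hy (h ▸ hyD))
    exact absurd (setDist_le_two hx hyD hxy) this.not_ge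
  have hnot : ∀ y : Fin n, (y.val < p.val ∨ q.val < y.val) → y ∉ ({p, q} : Finset (Fin n)) := by
    intro y hy h
    rw [Finset.mem_insert, Finset.mem_singleton] at h
    rcases h with rfl | rfl <;> omega
  have hbA : b ∉ A := fun h =>
    hnot b (by omega) (hC.mem_of_adj (x := p) (by simp) h (by omega))
  have hcA : c ∉ A := fun h =>
    hnot c (by omega) (hC.mem_of_adj (x := q) (by simp) h (by omega))
  obtain ⟨k, hk, hne⟩ := exists_isSupported him hγ hA hbA
    (hC.subset (by simp : p ∈ ({p, q} : Finset (Fin n))))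
  refine hne (hk.pair him hγ hb hpq hc hbA hcA ?_ ?_)
  · by_cases h1 : b.val = 0
    · rw [h1, leftSum_zero]
    · let d : Fin n := ⟨b.val - 1, by omega⟩
      have hd : b.val = d.val + 1 := by simp only [d]; omega
      exact (hk.leftSum_eq_zero_of_gap him hγ
        (hnear p (by simp) d (hnot d (by omega)) (by omega)) hbA hd).2
  · by_cases h1 : c.val + 1 = n
    · exact (hk.leftSum_eq_rightSum him hcA).trans (rightSum_of_le γ k h1.ge)
    · let d : Fin n := ⟨c.val + 1, by omega⟩
      have hd : d.val = c.val + 1 := rfl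
      exact (hk.leftSum_eq_zero_of_gap him hγ hcA
        (hnear q (by simp) d (hnot d (by omega)) (by omega)) hd).1

end FreeFermion

/-! ### Assembly of the four claims -/

theorem lemma8 (n : ℕ) (hn : 2 ≤ n) (γ : ℂ) (him : γ.im ≠ 0) (hγ : ‖γ‖ ≠ 1)
    (A : Finset (Fin n))
    (hA : ∃ O : FreeFermion.FockOp n, FreeFermion.IsBKExtensivelyLocal A O ∧
      FreeFermion.IsQuasiHermitian (FreeFermion.totalMetric (FreeFermion.farM n γ)) O) :
    -- (1) a component with at most two sites, other than the two exceptional pairs, is not alone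
    (∀ C : Finset (Fin n), FreeFermion.IsComponent A C → C.card ≤ 2 →
      C ≠ {⟨0, by omega⟩, ⟨1, by omega⟩} → C ≠ {⟨n - 2, by omega⟩, ⟨n - 1, by omega⟩} →
        (∃ D : Finset (Fin n), FreeFermion.IsComponent A D ∧ D ≠ C) ∧ A ≠ C) ∧
    -- (2) the sites at distance two from a single-site component belong to `A`
    (∀ i : Fin n, FreeFermion.IsComponent A {i} →
      ∀ j : Fin n, (j.val + 2 = i.val ∨ j.val = i.val + 2) → j ∈ A) ∧
    -- (3) a two-site component, unless exceptional, is within distance two of another component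
    (∀ C : Finset (Fin n), FreeFermion.IsComponent A C → C.card = 2 →
      C ≠ {⟨0, by omega⟩, ⟨1, by omega⟩} → C ≠ {⟨n - 2, by omega⟩, ⟨n - 1, by omega⟩} →
        ∃ D : Finset (Fin n), FreeFermion.IsComponent A D ∧ D ≠ C ∧
          FreeFermion.setDist C D ≤ 2) ∧
    -- (4) a leftmost or rightmost component with a single site is the endpoint of the chain
    (∀ (hne : A.Nonempty) (C : Finset (Fin n)), FreeFermion.IsComponent A C →
      (A.min' hne ∈ C → C.card = 1 → C = {⟨0, by omega⟩}) ∧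
      (A.max' hne ∈ C → C.card = 1 → C = {⟨n - 1, by omega⟩})) := by
  have h3 : ∀ C : Finset (Fin n), FreeFermion.IsComponent A C → C.card = 2 →
      C ≠ {⟨0, by omega⟩, ⟨1, by omega⟩} → C ≠ {⟨n - 2, by omega⟩, ⟨n - 1, by omega⟩} →
        ∃ D : Finset (Fin n), FreeFermion.IsComponent A D ∧ D ≠ C ∧
          FreeFermion.setDist C D ≤ 2 := by
    intro C hC hcard hC1 hC2
    obtain ⟨p, q, hpq, rfl⟩ := hC.eq_pair hcard
    refine FreeFermion.exists_component_near_pair him hγ hA hpq hC (fun h => hC1 ?_)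
      fun h => hC2 ?_
    · congr
      · exact Fin.ext h
      · exact Fin.ext (by simp only; omega)
    · congr
      · exact Fin.ext (by simp only; omega)
      · exact Fin.ext (by simp only; omega)
  have h1 : ∀ C : Finset (Fin n), FreeFermion.IsComponent A C → C.card ≤ 2 →
      C ≠ {⟨0, by omega⟩, ⟨1, by omega⟩} → C ≠ {⟨n - 2, by omega⟩, ⟨n - 1, by omega⟩} →
        ∃ D : Finset (Fin n), FreeFermion.IsComponent A D ∧ D ≠ C := by
    intro C hC hcard hC1 hC2
    have hpos := hC.nonempty.card_pos
    rcases (by omega : C.card = 1 ∨ C.card = 2) with h | h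
    · obtain ⟨i, rfl⟩ := Finset.card_eq_one.mp h
      by_contra! hcon
      have hAi : ∀ j ∈ A, j = i := by
        intro j hj
        obtain ⟨D, hD, hjD⟩ := FreeFermion.exists_isComponent hj
        rwa [hcon D hD, Finset.mem_singleton] at hjD
      have hl := FreeFermion.singleton_leftmost him hγ hA hC fun j hj => (hAi j hj).ge
      have hr := FreeFermion.singleton_rightmost him hγ hA hC fun j hj => (hAi j hj).le
      -- A lone single site would be both the first and the last of the chain, against `2 ≤ n`.
      omega
    · obtain ⟨D, hD, hne, -⟩ := h3 C hC h hC1 hC2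
      exact ⟨D, hD, hne⟩
  refine ⟨fun C hC hcard hC1 hC2 => ?_, ?_, h3, ?_⟩
  · obtain ⟨D, hD, hne⟩ := h1 C hC hcard hC1 hC2
    refine ⟨⟨D, hD, hne⟩, fun hAC => hne ?_⟩
    obtain ⟨x, hx⟩ := hD.nonempty
    exact hD.eq_of_mem hC hx (hAC ▸ hD.subset hx)
  · exact fun i hi j hj => FreeFermion.mem_of_singleton him hγ hA hi hj
  · intro hne C hC
    refine ⟨fun hmem hcard => ?_, fun hmem hcard => ?_⟩
    · obtain ⟨i, rfl⟩ := Finset.card_eq_one.mp hcard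
      have hi := Finset.mem_singleton.mp hmem
      have := FreeFermion.singleton_leftmost him hγ hA hC fun j hj => hi ▸ A.min'_le j hj
      exact congrArg _ (Fin.ext this)
    · obtain ⟨i, rfl⟩ := Finset.card_eq_one.mp hcard
      have hi := Finset.mem_singleton.mp hmem
      have := FreeFermion.singleton_rightmost him hγ hA hC fun j hj => hi ▸ A.le_max' j hj
      exact congrArg _ (Fin.ext (by simp only; omega))
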